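/- Let $n = 2k$, where $k \ge 3$ is an odd integer. Consider the lazy walk on the hypercube $(\mathbb Z/2\mathbb Z)^n$ that at each step stays put with probability $1/2$ and with probability $1/2$ flips a uniformly random set of $k = n/2$ coordinates; that is, the random walk driven by the probability measure $P$ with $P(0) = \frac12$, $P(g) = \frac{1}{2\binom{n}{k}}$ if $g$ has exactly $k$ ones, and $P(g) = 0$ otherwise. Let $P^{*l}$ denote the $l$-fold convolution power of $P$ (the law of the walk after $l$ steps from $0$), let $U$ be the uniform distribution on $(\mathbb Z/2\mathbb Z)^n$, and let $\|\mu-\nu\|_{T.V.} = \frac12\sum_x|\mu(x)-\nu(x)|$. Then for every real $c > 0$ and every integer $$l \ge 8\log\frac n2 + c\sqrt{\log\frac n2},$$ where $\log$ is the natural logarithm, one has $$\|P^{*l} - U\|_{T.V.} \le \frac{1}{c^2}.$$ -/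

import Mathlib

namespace KFlip

/-- The hypercube `(ℤ/2ℤ)ⁿ`, as an additive group. -/
abbrev Cube (n : ℕ) : Type := Fin n → ZMod 2

/-- One step of the lazy `k`-flip walk: mass `1/2` at the identity, and mass `1/(2 * C(n,k))` at
each vector with exactly `k` ones. (For `k = 0` the two contributions at the identity add up.) -/
noncomputable def lazyFlip (n k : ℕ) (g : Cube n) : ℝ :=
  (if g = 0 then 1 / 2 else 0) + (if hammingNorm g = k then 1 / (2 * (n.choose k : ℝ)) else 0)

/-- Convolution of two real functions on a finite additive group. -/
def conv {G : Type*} [AddCommGroup G] [Fintype G] (f g : G → ℝ) (x : G) : ℝ :=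
  ∑ y : G, f y * g (x - y)

/-- The `l`-fold convolution power; the `0`-th power is the point mass at the identity. -/
def convPow {G : Type*} [AddCommGroup G] [Fintype G] [DecidableEq G] (f : G → ℝ) : ℕ → G → ℝ
  | 0 => Pi.single 0 1
  | l + 1 => conv f (convPow f l)

/-- The uniform distribution on a finite type. -/
noncomputable def uniform (G : Type*) [Fintype G] (_x : G) : ℝ :=
  1 / (Fintype.card G : ℝ)

/-- Total variation distance between two probability mass functions on a finite type. -/
noncomputable def tvDist {G : Type*} [Fintype G] (p q : G → ℝ) : ℝ :=
  (1 / 2) * ∑ x : G, |p x - q x|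

end KFlip

namespace KFlip

/-! Plancherel applied directly to the lazy walk is too weak: the flip walk has eigenvalue `0` at
every odd weight, so laziness produces eigenvalue `1/2` with multiplicity `2^(n-1)`, which forces
`l` of order `n`. Instead, condition on the number `m` of actual flips, which is binomial. As `k` is
odd, `m` flips land on vectors of parity `m`, and the target is uniform on that parity class;
averaging these targets over `m` gives `U`.

At weight `j` the flip eigenvalue is `K_j(k) / C(2k, j)`. Since `(1 - X)^k (1 + X)^k = (1 - X^2)^k`,
it is `0` for odd `j` and `± C(k, i) / C(2k, 2i)` for `j = 2i`. The weights `0` and `2k` match the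
parity target exactly; elsewhere the eigenvalue is at most `1/k` in absolute value, and its square
times its multiplicity is at most `1`. Hence the `L¹` error after `m` flips is at most `k^(2 - m)`,
and the binomial average is `k^2 ((1 + 1/k)/2)^l`. -/

open Finset Polynomial

/-! ### Fourier analysis on the cube -/

/-- The nontrivial real character of `ℤ/2ℤ`. -/
noncomputable def sgn (a : ZMod 2) : ℝ := if a = 0 then 1 else -1

lemma zmod_two_cases (a : ZMod 2) : a = 0 ∨ a = 1 := by
  revert a; decide

lemma sgn_add (a b : ZMod 2) : sgn (a + b) = sgn a * sgn b := by
  have h2 : (1 : ZMod 2) + 1 = 0 := by decide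
  rcases zmod_two_cases a with rfl | rfl <;> rcases zmod_two_cases b with rfl | rfl <;>
    simp [sgn, h2]

lemma zmod_two_sum {M : Type*} [AddCommMonoid M] (f : ZMod 2 → M) : ∑ a, f a = f 0 + f 1 :=
  Fin.sum_univ_two f

/-- The character of the cube indexed by `y`. -/
noncomputable def chi {n : ℕ} (y x : Cube n) : ℝ := ∏ i, sgn (y i * x i)

variable {n : ℕ}

lemma chi_comm (y x : Cube n) : chi y x = chi x y := by
  simp [chi, mul_comm]

lemma chi_add (y x z : Cube n) : chi y (x + z) = chi y x * chi y z := by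
  simp [chi, mul_add, sgn_add, Finset.prod_mul_distrib]

lemma chi_zero_right (y : Cube n) : chi y 0 = 1 := by
  simp [chi, sgn]

lemma chi_zero_left (x : Cube n) : chi 0 x = 1 := by
  simp [chi, sgn]

lemma abs_chi (y x : Cube n) : |chi y x| = 1 := by
  unfold chi
  rw [Finset.abs_prod]
  refine Finset.prod_eq_one fun i _ => ?_
  unfold sgn
  split_ifs <;> simp

lemma sum_prod_coord {R : Type*} [CommSemiring R] (f : Fin n → ZMod 2 → R) :
    ∑ x : Cube n, ∏ i, f i (x i) = ∏ i, (f i 0 + f i 1) := by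
  simp_rw [← zmod_two_sum]
  rw [Finset.prod_univ_sum, Fintype.piFinset_univ]

lemma sum_chi (z : Cube n) : ∑ y, chi y z = if z = 0 then 2 ^ n else 0 := by
  have h : ∑ y : Cube n, chi y z = ∏ i, (sgn (0 * z i) + sgn (1 * z i)) :=
    sum_prod_coord fun i a => sgn (a * z i)
  rw [h]
  split_ifs with hz
  · subst hz
    simp [sgn]
    norm_num
  · obtain ⟨i, hi⟩ := Function.ne_iff.mp hz
    refine Finset.prod_eq_zero (mem_univ i) ?_
    have : z i ≠ 0 := hi
    simp [sgn, this]

/-- The Fourier transform on the cube. -/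
noncomputable def fourier (f : Cube n → ℝ) (y : Cube n) : ℝ := ∑ x, f x * chi y x

lemma fourier_sub (f g : Cube n → ℝ) (y : Cube n) :
    fourier (f - g) y = fourier f y - fourier g y := by
  simp [fourier, sub_mul, Finset.sum_sub_distrib]

lemma fourier_conv (f g : Cube n → ℝ) (y : Cube n) :
    fourier (conv f g) y = fourier f y * fourier g y := by
  unfold fourier conv
  simp_rw [Finset.sum_mul]
  rw [Finset.sum_comm]
  refine Finset.sum_congr rfl fun z _ => ?_
  rw [Finset.mul_sum, ← Equiv.sum_comp (Equiv.addRight z)]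
  refine Finset.sum_congr rfl fun x _ => ?_
  simp only [Equiv.coe_addRight, add_sub_cancel_right, chi_add]
  ring

lemma cube_sub_eq_add (x z : Cube n) : x - z = x + z := by
  ext i
  exact CharTwo.sub_eq_add _ _

lemma sum_fourier_sq (f : Cube n → ℝ) :
    ∑ y, fourier f y ^ 2 = 2 ^ n * ∑ x, f x ^ 2 := by
  have h : ∀ y : Cube n, fourier f y ^ 2 = ∑ x, ∑ z, f x * f z * chi y (x - z) := by
    intro y
    rw [sq, fourier, Finset.sum_mul_sum]
    refine Finset.sum_congr rfl fun x _ => Finset.sum_congr rfl fun z _ => ?_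
    rw [cube_sub_eq_add, chi_add]
    ring
  simp_rw [h]
  rw [Finset.sum_comm, Finset.mul_sum]
  refine Finset.sum_congr rfl fun x _ => ?_
  rw [Finset.sum_comm]
  simp_rw [← Finset.mul_sum, sum_chi, sub_eq_zero]
  simp
  ring

/-- Cauchy–Schwarz over the `2^n` points, whose factor is exactly that of Plancherel. -/
lemma sq_sum_abs_le (f : Cube n → ℝ) : (∑ x, |f x|) ^ 2 ≤ ∑ y, fourier f y ^ 2 := by
  rw [sum_fourier_sq]
  have h := sq_sum_le_card_mul_sum_sq (s := (univ : Finset (Cube n))) (f := fun x => |f x|)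
  simpa using h

/-! ### Krawtchouk numbers and the eigenvalues of the flip walk -/

/-- The Krawtchouk numbers, as coefficients of their generating polynomial. -/
noncomputable def krawtchouk (n k j : ℕ) : ℝ :=
  (((1 : ℝ[X]) - X) ^ j * (1 + X) ^ (n - j)).coeff k

lemma hammingNorm_eq_sum (x : Cube n) : hammingNorm x = ∑ i, if x i = 0 then 0 else 1 := by
  simp [hammingNorm, Finset.card_filter]

/-- The generating function in the weight of `x` factors over coordinates: `1 - X` where `y i ≠ 0`,
`1 + X` elsewhere. -/
lemma sum_chi_hammingNorm (y : Cube n) (k : ℕ) :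
    ∑ x : Cube n, (if hammingNorm x = k then chi y x else 0)
      = krawtchouk n k (hammingNorm y) := by
  have h : ∑ x : Cube n, C (chi y x) * (X : ℝ[X]) ^ hammingNorm x
      = (1 - X) ^ hammingNorm y * (1 + X) ^ (n - hammingNorm y) := by
    have h1 : ∀ x : Cube n, C (chi y x) * (X : ℝ[X]) ^ hammingNorm x
        = ∏ i, (C (sgn (y i * x i)) * X ^ (if x i = 0 then 0 else 1)) := by
      intro x
      rw [Finset.prod_mul_distrib, chi, map_prod, hammingNorm_eq_sum, Finset.prod_pow_eq_pow_sum]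
    simp_rw [h1]
    refine (sum_prod_coord
      fun i a => C (sgn (y i * a)) * (X : ℝ[X]) ^ (if a = 0 then 0 else 1)).trans ?_
    have h2 : ∀ i, (C (sgn (y i * 0)) * (X : ℝ[X]) ^ (if (0 : ZMod 2) = 0 then 0 else 1)
        + C (sgn (y i * 1)) * X ^ (if (1 : ZMod 2) = 0 then 0 else 1))
        = if y i ≠ 0 then 1 - X else 1 + X := by
      intro i
      by_cases hy : y i = 0 <;> simp [sgn, hy, sub_eq_add_neg]
    rw [Finset.prod_congr rfl fun i _ => h2 i, Finset.prod_ite, Finset.prod_const, Finset.prod_const]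
    have h3 := Finset.card_filter_add_card_filter_not (s := (univ : Finset (Fin n)))
      (fun i => y i ≠ 0)
    rw [Finset.card_univ, Fintype.card_fin] at h3
    congr 2
    exact Nat.eq_sub_of_add_eq' h3
  rw [krawtchouk, ← h, finsetSum_coeff]
  refine Finset.sum_congr rfl fun x _ => ?_
  rw [coeff_C_mul, coeff_X_pow]
  by_cases hx : hammingNorm x = k
  · simp [hx]
  · rw [if_neg hx, if_neg (Ne.symm hx), mul_zero]

lemma sum_hammingNorm (k : ℕ) :
    ∑ x : Cube n, (if hammingNorm x = k then (1 : ℝ) else 0) = n.choose k := by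
  have h := sum_chi_hammingNorm (0 : Cube n) k
  simp_rw [chi_zero_left] at h
  rw [h, krawtchouk, hammingNorm_zero, pow_zero, one_mul, Nat.sub_zero, coeff_one_add_X_pow]

/-- Both sides sum the symmetric kernel `chi` over pairs of vectors of weights `j` and `k`. This
moves the evaluation point to `k`, where the generating polynomial simplifies. -/
lemma choose_mul_krawtchouk (n k j : ℕ) :
    (n.choose j : ℝ) * krawtchouk n k j = n.choose k * krawtchouk n j k := by
  have key : ∀ k j : ℕ, (n.choose j : ℝ) * krawtchouk n k j =
      ∑ y : Cube n, ∑ x : Cube n,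
        (if hammingNorm y = j then if hammingNorm x = k then chi y x else 0 else 0) := by
    intro k j
    rw [← sum_hammingNorm, Finset.sum_mul]
    refine Finset.sum_congr rfl fun y _ => ?_
    split_ifs with hy
    · rw [sum_chi_hammingNorm, hy, one_mul]
    · simp
  rw [key k j, key j k, Finset.sum_comm]
  refine Finset.sum_congr rfl fun y _ => Finset.sum_congr rfl fun x _ => ?_
  rw [chi_comm]
  split_ifs <;> rfl

lemma coeff_one_sub_X_pow (k i : ℕ) :
    (((1 : ℝ[X]) - X) ^ k).coeff i = (-1) ^ i * (k.choose i : ℝ) := by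
  have h : ((1 : ℝ[X]) - X) ^ k = ((1 + X) ^ k).comp (C (-1) * X) := by
    simp [sub_eq_add_neg]
  rw [h, comp_C_mul_X_coeff, coeff_one_add_X_pow, mul_comm]

lemma krawtchouk_half (k j : ℕ) :
    krawtchouk (2 * k) j k = if 2 ∣ j then (-1) ^ (j / 2) * (k.choose (j / 2) : ℝ) else 0 := by
  have h : ((1 : ℝ[X]) - X) ^ k * (1 + X) ^ (2 * k - k) = expand ℝ 2 ((1 - X) ^ k) := by
    rw [show 2 * k - k = k by omega, ← mul_pow]
    simp only [map_pow, map_sub, map_one, expand_X]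
    congr 1
    ring
  rw [krawtchouk, h, coeff_expand (by norm_num), coeff_one_sub_X_pow]

/-- One step of the walk that flips a uniformly random set of `k` coordinates. -/
noncomputable def flip (n k : ℕ) (g : Cube n) : ℝ :=
  if hammingNorm g = k then 1 / (n.choose k : ℝ) else 0

lemma fourier_flip {k : ℕ} (hk : k ≤ n) (y : Cube n) :
    fourier (flip n k) y = krawtchouk n (hammingNorm y) k / n.choose (hammingNorm y) := by
  have hy : (n.choose (hammingNorm y) : ℝ) ≠ 0 := by
    have : hammingNorm y ≤ n := by simpa using hammingNorm_le_card_fintype (x := y)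
    exact_mod_cast (Nat.choose_pos this).ne'
  have hk' : (n.choose k : ℝ) ≠ 0 := by exact_mod_cast (Nat.choose_pos hk).ne'
  have h : fourier (flip n k) y = krawtchouk n k (hammingNorm y) / n.choose k := by
    rw [← sum_chi_hammingNorm, fourier, Finset.sum_div]
    refine Finset.sum_congr rfl fun x _ => ?_
    unfold flip
    split_ifs <;> ring
  rw [h, div_eq_div_iff hk' hy, mul_comm, choose_mul_krawtchouk, mul_comm]

/-! ### Binomial mixture and parity classes -/

/-- Convolution by `f` as a linear operator. -/
def convLin {G : Type*} [AddCommGroup G] [Fintype G] (f : G → ℝ) : Module.End ℝ (G → ℝ) where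
  toFun := conv f
  map_add' g h := by
    ext x
    simp [conv, mul_add, Finset.sum_add_distrib]
  map_smul' a g := by
    ext x
    simp only [conv, Pi.smul_apply, smul_eq_mul, RingHom.id_apply, Finset.mul_sum]
    exact Finset.sum_congr rfl fun y _ => by ring

lemma convPow_eq_convLin_pow {G : Type*} [AddCommGroup G] [Fintype G] [DecidableEq G]
    (f : G → ℝ) (m : ℕ) : convPow f m = (convLin f ^ m) (Pi.single 0 1) := by
  induction m with
  | zero => rfl
  | succ m ih =>
    rw [pow_succ', Module.End.mul_apply, ← ih]
    rfl

lemma convLin_lazyFlip (n k : ℕ) :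
    convLin (lazyFlip n k) = (1 / 2 : ℝ) • (convLin (flip n k) + 1) := by
  refine LinearMap.ext fun g => funext fun x => ?_
  have h : ∀ y, lazyFlip n k y * g (x - y)
      = (if y = 0 then 1 / 2 * g (x - y) else 0) + 1 / 2 * (flip n k y * g (x - y)) := by
    intro y
    unfold lazyFlip flip
    split_ifs <;> ring
  change conv (lazyFlip n k) g x = (1 / 2 : ℝ) * (conv (flip n k) g x + g x)
  simp only [conv, h, Finset.sum_add_distrib, ← Finset.mul_sum]
  simp
  ring

/-- The lazy walk is a binomial mixture of the non-lazy walks. -/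
lemma convPow_lazyFlip (n k l : ℕ) (x : Cube n) :
    convPow (lazyFlip n k) l x
      = ∑ m ∈ range (l + 1), (l.choose m : ℝ) / 2 ^ l * convPow (flip n k) m x := by
  rw [convPow_eq_convLin_pow, convLin_lazyFlip, _root_.smul_pow, (Commute.one_right _).add_pow]
  simp only [one_pow, mul_one, LinearMap.smul_apply, LinearMap.sum_apply, Pi.smul_apply,
    Finset.sum_apply, smul_eq_mul, Finset.mul_sum]
  refine Finset.sum_congr rfl fun m _ => ?_
  rw [convPow_eq_convLin_pow, ← nsmul_eq_mul', LinearMap.smul_apply, Pi.smul_apply, nsmul_eq_mul,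
    one_div, inv_pow]
  ring

/-- The uniform distribution on the vectors whose number of ones has the parity of `m`. -/
noncomputable def parityUniform (n m : ℕ) (x : Cube n) : ℝ := (1 + (-1) ^ m * chi 1 x) / 2 ^ n

/-- A binomial `m` with `l ≠ 0` is even or odd with equal probability, so the parity terms cancel.
-/
lemma uniform_eq_sum_parityUniform {l : ℕ} (hl : l ≠ 0) (x : Cube n) :
    uniform (Cube n) x = ∑ m ∈ range (l + 1), (l.choose m : ℝ) / 2 ^ l * parityUniform n m x := by
  have h1 : ∑ m ∈ range (l + 1), (l.choose m : ℝ) = 2 ^ l := by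
    exact_mod_cast Nat.sum_range_choose l
  have h2 : ∑ m ∈ range (l + 1), (-1 : ℝ) ^ m * l.choose m = 0 := by
    exact_mod_cast Int.alternating_sum_range_choose_of_ne hl
  have h3 : ∀ m, (l.choose m : ℝ) / 2 ^ l * parityUniform n m x
      = 1 / (2 ^ l * 2 ^ n) * (l.choose m)
        + chi 1 x / (2 ^ l * 2 ^ n) * ((-1) ^ m * l.choose m) := by
    intro m
    unfold parityUniform
    field_simp
  simp_rw [h3]
  rw [Finset.sum_add_distrib, ← Finset.mul_sum, ← Finset.mul_sum, h1, h2]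
  simp [uniform]

lemma fourier_convPow (f : Cube n → ℝ) (m : ℕ) (y : Cube n) :
    fourier (convPow f m) y = fourier f y ^ m := by
  induction m with
  | zero =>
    rw [fourier, Finset.sum_eq_single 0]
    · simp [convPow, chi_zero_right]
    · intro x _ hx
      simp [convPow, hx]
    · simp
  | succ m ih => rw [convPow, fourier_conv, ih, pow_succ']

lemma fourier_parityUniform (m : ℕ) (y : Cube n) :
    fourier (parityUniform n m) y
      = (if y = 0 then 1 else 0) + (-1) ^ m * (if y = 1 then 1 else 0) := by
  have h : ∀ x, parityUniform n m x * chi y x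
      = 1 / 2 ^ n * chi x y + (-1) ^ m / 2 ^ n * chi x (y - 1) := by
    intro x
    rw [cube_sub_eq_add, chi_add, chi_comm x y, chi_comm x 1, parityUniform]
    ring
  rw [fourier]
  simp_rw [h]
  rw [Finset.sum_add_distrib, ← Finset.mul_sum, ← Finset.mul_sum, sum_chi, sum_chi]
  simp only [sub_eq_zero]
  split_ifs <;> simp

/-! ### Distance to the parity targets -/

lemma hammingNorm_eq_iff_eq_one (y : Cube n) : hammingNorm y = n ↔ y = 1 := by
  constructor
  · intro h
    have h1 : (univ.filter fun i => y i ≠ 0) = (univ : Finset (Fin n)) := by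
      rw [← Finset.card_eq_iff_eq_univ, Fintype.card_fin]
      exact h
    ext i
    have h2 : y i ≠ 0 := by
      have : i ∈ (univ.filter fun i => y i ≠ 0) := by rw [h1]; exact mem_univ i
      exact (Finset.mem_filter.mp this).2
    rw [(zmod_two_cases (y i)).resolve_left h2]
    rfl
  · rintro rfl
    simp [hammingNorm]

lemma sum_radial (g : ℕ → ℝ) :
    ∑ y : Cube n, g (hammingNorm y) = ∑ j ∈ range (n + 1), (n.choose j : ℝ) * g j := by
  simp_rw [← sum_hammingNorm (n := n), Finset.sum_mul]
  rw [Finset.sum_comm]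
  refine Finset.sum_congr rfl fun y _ => ?_
  have hy : hammingNorm y < n + 1 := by
    have := hammingNorm_le_card_fintype (x := y)
    rw [Fintype.card_fin] at this
    omega
  simp [hy]

lemma self_le_choose {k i : ℕ} (hi : 0 < i) (hik : i < k) : k ≤ k.choose i := by
  induction k with
  | zero => omega
  | succ k ih =>
    obtain ⟨i, rfl⟩ := Nat.exists_eq_succ_of_ne_zero hi.ne'
    rw [Nat.succ_eq_add_one, Nat.choose_succ_succ]
    have h1 : 0 < k.choose i := Nat.choose_pos (by omega)
    rcases Nat.lt_or_ge (i + 1) k with h | h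
    · have := ih h
      simp only [Nat.succ_eq_add_one] at *
      omega
    · obtain rfl : k = i + 1 := by omega
      simp

/-- The `(i, i)` term of Vandermonde's sum. -/
lemma choose_sq_le (k i : ℕ) : k.choose i ^ 2 ≤ (2 * k).choose (2 * i) := by
  rw [two_mul k, Nat.add_choose_eq, sq]
  exact Finset.single_le_sum (f := fun ij : ℕ × ℕ => k.choose ij.1 * k.choose ij.2)
    (fun _ _ => Nat.zero_le _) (by simp [two_mul] : (i, i) ∈ antidiagonal (2 * i))

/-- With `a = C(k, i)` and `b = C(2k, 2i)`, `k ≤ a` and `a^2 ≤ b`. One squared eigenvalue absorbs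
the multiplicity `b`; the remaining factors use `a / b ≤ 1 / a ≤ 1 / k`. -/
lemma choose_mul_eigenvalue_pow_le {k j p : ℕ} (hj : j ≠ 0) (hjk : j < 2 * k) :
    ((2 * k).choose j : ℝ) *
        ((krawtchouk (2 * k) j k / (2 * k).choose j) ^ (p + 1)) ^ 2 ≤ ((1 / k : ℝ) ^ p) ^ 2 := by
  rw [krawtchouk_half]
  split_ifs with h
  · obtain ⟨i, rfl⟩ := h
    have hk : (0 : ℝ) < k := by exact_mod_cast (by omega : 0 < k)
    have h1 : (k : ℝ) ≤ k.choose i := by exact_mod_cast self_le_choose (by omega) (by omega)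
    have h2 : (k.choose i : ℝ) ^ 2 ≤ (2 * k).choose (2 * i) := by exact_mod_cast choose_sq_le k i
    rw [Nat.mul_div_cancel_left i two_pos]
    set a : ℝ := (k.choose i : ℝ)
    set b : ℝ := ((2 * k).choose (2 * i) : ℝ)
    have ha : 0 < a := hk.trans_le h1
    have hb : 0 < b := (pow_pos ha 2).trans_le h2
    have h3 : b * (a / b) ^ 2 ≤ 1 := by
      rw [div_pow, ← mul_div_assoc, div_le_one (by positivity), sq b]
      exact mul_le_mul_of_nonneg_left h2 hb.le
    have h4 : a / b ≤ 1 / k := by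
      rw [div_le_div_iff₀ hb hk]
      nlinarith
    have h5 : (((-1) ^ i * a / b) ^ (p + 1)) ^ 2 = ((a / b) ^ 2) * ((a / b) ^ p) ^ 2 := by
      rw [mul_div_assoc, mul_pow, mul_pow, ← pow_mul, ← pow_mul,
        show i * ((p + 1) * 2) = 2 * (i * (p + 1)) by ring, pow_mul (-1 : ℝ)]
      norm_num
      ring
    rw [h5, ← mul_assoc]
    calc b * (a / b) ^ 2 * ((a / b) ^ p) ^ 2 ≤ 1 * ((1 / k : ℝ) ^ p) ^ 2 := by gcongr
      _ = _ := one_mul _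
  · simp

/-- The eigenvalues at weights `0` and `2k` are `1` and `(-1)^k = -1`, exactly what the parity
target carries. -/
lemma fourier_flip_sub_parityUniform {k : ℕ} (hodd : Odd k) (m : ℕ) (y : Cube (2 * k)) :
    fourier (convPow (flip (2 * k) k) m - parityUniform (2 * k) m) y
      = if hammingNorm y = 0 ∨ hammingNorm y = 2 * k then 0
        else (krawtchouk (2 * k) (hammingNorm y) k / (2 * k).choose (hammingNorm y)) ^ m := by
  have hk : k ≠ 0 := by rintro rfl; simp at hodd
  rw [fourier_sub, fourier_convPow, fourier_flip (by omega), fourier_parityUniform]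
  simp only [← hammingNorm_eq_zero (x := y), ← hammingNorm_eq_iff_eq_one]
  generalize hammingNorm y = j
  have h2 : 2 * k ≠ 0 := by omega
  by_cases h0 : j = 0
  · subst h0
    simp [krawtchouk_half, h2.symm]
  · by_cases h1 : j = 2 * k
    · subst h1
      simp [krawtchouk_half, hk, hodd.neg_one_pow]
    · simp [h0, h1]

lemma sum_abs_flip_sub_parityUniform_le {k : ℕ} (hodd : Odd k) (hk : 1 < k) (m : ℕ) :
    ∑ x, |convPow (flip (2 * k) k) m x - parityUniform (2 * k) m x|
      ≤ (k : ℝ) ^ 2 * (1 / k) ^ m := by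
  have hk2 : (2 : ℝ) ≤ k := by exact_mod_cast hk
  cases m with
  -- No eigenvalue is available to absorb the multiplicity when `m = 0`; the trivial bound `1 + 2 =
  -- 3 ≤ k^2` suffices.
  | zero =>
    have h1 : ∀ x : Cube (2 * k), |convPow (flip (2 * k) k) 0 x - parityUniform (2 * k) 0 x|
        ≤ (if x = 0 then 1 else 0) + 2 / 2 ^ (2 * k) := by
      intro x
      refine (abs_sub _ _).trans (add_le_add ?_ ?_)
      · by_cases hx : x = 0 <;> simp [convPow, hx]
      · rw [parityUniform, abs_div, abs_of_pos (by positivity : (0 : ℝ) < 2 ^ (2 * k))]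
        gcongr
        refine (abs_add_le _ _).trans ?_
        rw [pow_zero, one_mul, abs_chi]
        norm_num
    have hk3 : (3 : ℝ) ≤ k := by
      obtain ⟨t, rfl⟩ := hodd
      exact_mod_cast (by omega : 3 ≤ 2 * t + 1)
    calc _ ≤ ∑ x : Cube (2 * k), ((if x = 0 then (1 : ℝ) else 0) + 2 / 2 ^ (2 * k)) :=
          Finset.sum_le_sum fun x _ => h1 x
      _ = 3 := by
          rw [Finset.sum_add_distrib]
          simp
          field_simp
          norm_num
      _ ≤ _ := by
          rw [pow_zero, mul_one]
          nlinarith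
  | succ p =>
    refine abs_le_of_sq_le_sq' ?_ (by positivity) |>.2
    refine (sq_sum_abs_le
      (convPow (flip (2 * k) k) (p + 1) - parityUniform (2 * k) (p + 1))).trans ?_
    simp_rw [fourier_flip_sub_parityUniform hodd]
    rw [sum_radial fun j => (if j = 0 ∨ j = 2 * k then 0
        else (krawtchouk (2 * k) j k / (2 * k).choose j) ^ (p + 1)) ^ 2,
      Finset.sum_range_succ']
    have h1 : ∀ j ∈ range (2 * k), ((2 * k).choose (j + 1) : ℝ) *
        (if j + 1 = 0 ∨ j + 1 = 2 * k then 0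
          else (krawtchouk (2 * k) (j + 1) k / (2 * k).choose (j + 1)) ^ (p + 1)) ^ 2
        ≤ ((1 / k : ℝ) ^ p) ^ 2 := by
      intro j hj
      rw [Finset.mem_range] at hj
      by_cases h : j + 1 = 0 ∨ j + 1 = 2 * k
      · rw [if_pos h, zero_pow two_ne_zero, mul_zero]
        positivity
      · rw [if_neg h]
        exact choose_mul_eigenvalue_pow_le (by omega) (by omega)
    calc _ ≤ ∑ j ∈ range (2 * k), ((1 / k : ℝ) ^ p) ^ 2 + 0 :=
          add_le_add (Finset.sum_le_sum h1) (by simp)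
      _ = (2 * k) * ((1 / k : ℝ) ^ p) ^ 2 := by simp
      _ ≤ (k * k) * ((1 / k : ℝ) ^ p) ^ 2 := by gcongr
      _ = _ := by
          rw [pow_succ _ p]
          field_simp

lemma tvDist_lazyFlip_le {k l : ℕ} (hodd : Odd k) (hk : 1 < k) (hl : l ≠ 0) :
    tvDist (convPow (lazyFlip (2 * k) k) l) (uniform (Cube (2 * k)))
      ≤ (k : ℝ) ^ 2 / 2 * ((1 + 1 / k) / 2) ^ l := by
  have h1 : ∀ x : Cube (2 * k), |convPow (lazyFlip (2 * k) k) l x - uniform (Cube (2 * k)) x|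
      ≤ ∑ m ∈ range (l + 1), (l.choose m : ℝ) / 2 ^ l *
        |convPow (flip (2 * k) k) m x - parityUniform (2 * k) m x| := by
    intro x
    rw [convPow_lazyFlip, uniform_eq_sum_parityUniform hl, ← Finset.sum_sub_distrib]
    refine (Finset.abs_sum_le_sum_abs _ _).trans (Finset.sum_le_sum fun m _ => ?_)
    rw [← mul_sub, abs_mul, abs_of_nonneg (by positivity)]
  have h2 : ∑ x, |convPow (lazyFlip (2 * k) k) l x - uniform (Cube (2 * k)) x|
      ≤ (k : ℝ) ^ 2 * ((1 + 1 / k) / 2) ^ l := by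
    calc _ ≤ ∑ x, ∑ m ∈ range (l + 1), (l.choose m : ℝ) / 2 ^ l *
          |convPow (flip (2 * k) k) m x - parityUniform (2 * k) m x| :=
          Finset.sum_le_sum fun x _ => h1 x
      _ = ∑ m ∈ range (l + 1), (l.choose m : ℝ) / 2 ^ l *
          ∑ x, |convPow (flip (2 * k) k) m x - parityUniform (2 * k) m x| := by
          rw [Finset.sum_comm]
          simp_rw [Finset.mul_sum]
      _ ≤ ∑ m ∈ range (l + 1), (l.choose m : ℝ) / 2 ^ l * ((k : ℝ) ^ 2 * (1 / k) ^ m) := by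
          gcongr with m _
          exact sum_abs_flip_sub_parityUniform_le hodd hk m
      _ = _ := by
          rw [div_pow, add_comm (1 : ℝ), add_pow, Finset.sum_div, Finset.mul_sum]
          refine Finset.sum_congr rfl fun m _ => ?_
          rw [one_pow]
          ring
  unfold tvDist
  linarith

/-! ### Numerical estimates -/

lemma two_thirds_le_exp : (2 / 3 : ℝ) ≤ Real.exp (-(3 / 8)) := by
  have h1 : Real.exp (3 / 8) ≤ 3 / 2 := by
    -- The eighth power reduces this to `e^3 ≤ (3/2)^8`.
    refine le_of_pow_le_pow_left₀ (n := 8) (by norm_num) (by norm_num) ?_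
    rw [← Real.exp_nat_mul, show ((8 : ℕ) : ℝ) * (3 / 8) = ((3 : ℕ) : ℝ) * 1 by norm_num,
      Real.exp_nat_mul]
    calc Real.exp 1 ^ 3 ≤ 2.7182818286 ^ 3 := by
          gcongr
          exact Real.exp_one_lt_d9.le
      _ ≤ _ := by norm_num
  rw [Real.exp_neg, le_inv_comm₀ (by norm_num) (Real.exp_pos _)]
  linarith

lemma sq_le_six_mul_exp {c : ℝ} (hc : 0 < c) : c ^ 2 ≤ 6 * Real.exp (3 / 8 * c) := by
  have h1 : 3 / 16 * c ≤ Real.exp (3 / 16 * c - 1) := by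
    have := Real.add_one_le_exp (3 / 16 * c - 1)
    linarith
  have h2 : Real.exp (3 / 8 * c) = Real.exp (3 / 16 * c - 1) ^ 2 * Real.exp 1 ^ 2 := by
    rw [← mul_pow, ← Real.exp_add, ← Real.exp_nat_mul]
    congr 1
    push_cast
    ring
  have h3 : (3 / 16 * c) ^ 2 ≤ Real.exp (3 / 16 * c - 1) ^ 2 := by gcongr
  have h4 : (2.7 : ℝ) ^ 2 ≤ Real.exp 1 ^ 2 := by
    gcongr
    linarith [Real.exp_one_gt_d9]
  have h5 := mul_le_mul h3 h4 (by positivity) (by positivity)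
  rw [h2]
  nlinarith [sq_nonneg c]

/-- The rate `3/8` turns `8 log k` into `k^(-3)`, leaving `1/(2k) ≤ 1/6` times `e^(-3c/8)`; hence
the `6` in `sq_le_six_mul_exp`. -/
lemma half_sq_mul_pow_le {k l : ℕ} {c : ℝ} (hk : 3 ≤ k) (hc : 0 < c)
    (hl : 8 * Real.log k + c * √(Real.log k) ≤ l) :
    (k : ℝ) ^ 2 / 2 * ((1 + 1 / k) / 2) ^ l ≤ 1 / c ^ 2 := by
  have hk3 : (3 : ℝ) ≤ k := by exact_mod_cast hk
  have hk0 : (0 : ℝ) < k := by linarith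
  have hlog : 1 ≤ Real.log k := by
    rw [Real.le_log_iff_exp_le hk0]
    linarith [Real.exp_one_lt_d9]
  have hl' : 8 * Real.log k + c ≤ l := by
    have : c * 1 ≤ c * √(Real.log k) := by
      gcongr
      exact Real.one_le_sqrt.mpr hlog
    linarith
  have h1 : ((1 + 1 / k : ℝ) / 2) ≤ 2 / 3 := by
    have : (1 / k : ℝ) ≤ 1 / 3 := by gcongr
    linarith
  have h2 : ((1 + 1 / k : ℝ) / 2) ^ l ≤ Real.exp (-(3 / 8 * c)) / k ^ 3 := by
    calc ((1 + 1 / k : ℝ) / 2) ^ l ≤ Real.exp (-(3 / 8)) ^ l := by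
          gcongr
          exact h1.trans two_thirds_le_exp
      _ = Real.exp (l * -(3 / 8)) := (Real.exp_nat_mul _ _).symm
      _ ≤ Real.exp (-(3 / 8 * c) - (3 : ℕ) * Real.log k) := by
          gcongr
          push_cast
          linarith
      _ = _ := by rw [Real.exp_sub, Real.exp_nat_mul, Real.exp_log hk0]
  calc (k : ℝ) ^ 2 / 2 * ((1 + 1 / k) / 2) ^ l
      ≤ (k : ℝ) ^ 2 / 2 * (Real.exp (-(3 / 8 * c)) / k ^ 3) := by gcongr
    _ = 1 / (2 * k * Real.exp (3 / 8 * c)) := by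
        rw [Real.exp_neg]
        field_simp
    _ ≤ 1 / c ^ 2 := by
        gcongr
        refine (sq_le_six_mul_exp hc).trans ?_
        gcongr
        linarith

end KFlip

theorem theorem3 (n k : ℕ) (hn : n = 2 * k) (hodd : Odd k) (hk : 1 < k)
    (c : ℝ) (hc : 0 < c) (l : ℕ)
    (hl : 8 * Real.log ((n : ℝ) / 2) + c * √(Real.log ((n : ℝ) / 2)) ≤ (l : ℝ)) :
    KFlip.tvDist (KFlip.convPow (KFlip.lazyFlip n k) l) (KFlip.uniform (KFlip.Cube n))
      ≤ 1 / c ^ 2 := by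
  subst hn
  rw [show ((2 * k : ℕ) : ℝ) / 2 = k by push_cast; ring] at hl
  have hk3 : 3 ≤ k := by
    obtain ⟨t, rfl⟩ := hodd
    omega
  have hl0 : l ≠ 0 := by
    rintro rfl
    have hlog : 0 < Real.log k := Real.log_pos (by exact_mod_cast hk)
    have : 0 ≤ c * √(Real.log k) := by positivity
    push_cast at hl
    linarith
  exact (KFlip.tvDist_lazyFlip_le hodd hk hl0).trans (KFlip.half_sq_mul_pow_le hk3 hc hl)
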